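/- Let $G$ be a finite group and $F$ a field whose characteristic does not divide $|G|$; all modules are finite dimensional over $F$. For an $FG$-module $W$, let $S(W)=\bigoplus_{d\ge 0}S(W)_d$ be the symmetric algebra with its standard grading and with the action of $G$ by $F$-algebra automorphisms extending the action on $W$, let $S(W)^G$ be the graded subalgebra of invariants, and let $S(W)^G_+$ be its ideal spanned by the homogeneous invariants of positive degree. For a graded vector space $X=\bigoplus_{d\ge 0} X_d$ put $\mathrm{topdeg}(X)=\sup\{d\mid X_d\ne 0\}$. For a positive integer $k$ define \[\beta_k(G,W)=\mathrm{topdeg}\bigl(S(W)^G/(S(W)^G_+)^{k+1}\bigr),\qquad b_k(G,W)=\mathrm{topdeg}\bigl(S(W)/(S(W)^G_+)^kS(W)\bigr),\] and let $\beta_k(G)$ (the $k$-th Noether number) and $b_k(G)$ be the suprema of $\beta_k(G,W)$ and of $b_k(G,W)$, respectively, over all $FG$-modules $W$. The same notation is used for subgroups of $G$. Theorem. Let $H\subsetneq G$ be a proper subgroup and let $k\ge 1$. For every $FH$-module $V$, \[b_k(G,\mathrm{Ind}_H^G V)\ \ge\ \beta_k(H,V).\] In particular, \[b_k(G)\ \ge\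 \beta_k(H),\qquad\text{and}\qquad \beta_k(G)\ >\ \beta_k(H).\] -/

import Mathlib

universe u v w

noncomputable section

namespace NoetherNumber

/-- The top degree `sup {d | X_d ≠ 0}` of a space graded by the family of subspaces `X`,
as an extended natural number. -/
def topDeg {F : Type u} [Field F] {M : Type w} [AddCommGroup M] [Module F M]
    (X : ℕ → Submodule F M) : ℕ∞ :=
  sSup {e : ℕ∞ | ∃ d : ℕ, X d ≠ ⊥ ∧ e = (d : ℕ∞)}

section Rep

variable {F : Type u} [Field F] {G : Type v} [Group G]
  {W : Type w} [AddCommGroup W] [Module F W]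

/-- The homogeneous component `S(W)_d` of the symmetric algebra: the span of the `d`-fold
products of elements of `W` (for `d = 0` it is the line of constants). -/
def symComponent (F : Type u) [Field F] (W : Type w) [AddCommGroup W] [Module F W] (d : ℕ) :
    Submodule F (SymmetricAlgebra F W) :=
  (LinearMap.range (SymmetricAlgebra.ι F W)) ^ d

/-- The action of `G` on `S(W)` by `F`-algebra endomorphisms that extends the linear action
of `G` on `W`. -/
def symAction (ρ : Representation F G W) :
    G →* (SymmetricAlgebra F W →ₐ[F] SymmetricAlgebra F W) where
  toFun g := SymmetricAlgebra.lift (SymmetricAlgebra.ι F W ∘ₗ ρ g)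
  map_one' := by
    apply SymmetricAlgebra.algHom_ext
    ext x
    simp
  map_mul' g h := by
    apply SymmetricAlgebra.algHom_ext
    ext x
    simp

/-- The subalgebra `S(W)^G` of invariants. -/
def invariants (ρ : Representation F G W) : Subalgebra F (SymmetricAlgebra F W) where
  carrier := {f | ∀ g : G, symAction ρ g f = f}
  mul_mem' ha hb g := by rw [map_mul, ha g, hb g]
  add_mem' ha hb g := by rw [map_add, ha g, hb g]
  algebraMap_mem' r g := AlgHom.commutes _ r

/-- The homogeneous component `(S(W)^G)_d = S(W)^G ∩ S(W)_d`. -/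
def invComponent (ρ : Representation F G W) (d : ℕ) : Submodule F (invariants ρ) :=
  (symComponent F W d).comap (invariants ρ).val.toLinearMap

/-- The ideal `S(W)^G_+` of `S(W)^G` spanned by the homogeneous components of positive
degree. -/
def invPlus (ρ : Representation F G W) : Ideal (invariants ρ) :=
  Ideal.span (⋃ d : {d : ℕ // 0 < d}, (invComponent ρ d : Set (invariants ρ)))

/-- `β_k(G, W)`, the top degree of `S(W)^G / (S(W)^G_+)^(k+1)`. -/
def betaRep (k : ℕ) (ρ : Representation F G W) : ℕ∞ :=
  topDeg fun d : ℕ =>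
    (invComponent ρ d).map (Ideal.Quotient.mkₐ F (invPlus ρ ^ (k + 1))).toLinearMap

/-- The ideal `(S(W)^G_+)^k S(W)` of `S(W)`. -/
def hilbertIdeal (k : ℕ) (ρ : Representation F G W) : Ideal (SymmetricAlgebra F W) :=
  (invPlus ρ ^ k).map (algebraMap (invariants ρ) (SymmetricAlgebra F W))

/-- `b_k(G, W)`, the top degree of `S(W) / (S(W)^G_+)^k S(W)`. -/
def bRep (k : ℕ) (ρ : Representation F G W) : ℕ∞ :=
  topDeg fun d : ℕ =>
    (symComponent F W d).map (Ideal.Quotient.mkₐ F (hilbertIdeal k ρ)).toLinearMap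

end Rep

/-- The `k`-th Noether number `β_k(G)` over `F`: the supremum of `β_k(G, W)` over all
finite-dimensional representations `W` of `G` over `F`. -/
def beta (F : Type u) [Field F] (G : Type v) [Group G] (k : ℕ) : ℕ∞ :=
  ⨆ (W : Type (max u v)) (_ : AddCommGroup W) (_ : Module F W) (_ : Module.Finite F W)
    (ρ : Representation F G W), betaRep k ρ

/-- `b_k(G)` over `F`: the supremum of `b_k(G, W)` over all finite-dimensional representations
`W` of `G` over `F`. -/
def b (F : Type u) [Field F] (G : Type v) [Group G] (k : ℕ) : ℕ∞ :=
  ⨆ (W : Type (max u v)) (_ : AddCommGroup W) (_ : Module F W) (_ : Module.Finite F W)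
    (ρ : Representation F G W), bRep k ρ

end NoetherNumber

end

/-! Let `i : V → Ind V` be the inclusion, `p` the `H`-equivariant projection back, and `g ∉ H`, so
that `p g i = 0`. For `x = s a` with `a` in the `k`-th power of the ideal of positive invariants of
`G`, `p(x) - p(g x) = p(a) (p(s) - p(g s))`. The second factor has no constant term, so the transfer
over `H` lands in the `(k+1)`-st power of the ideal for `H` (`transfer_symMap_sub_mem`). If `f` is
an invariant of `H` of positive degree, then `x = i(f)` gives `|H| f`; hence `f` outside that power
forces `i(f)` outside the `k`-th power of the Hilbert ideal.

Strictness follows from `b_k(G) + 1 ≤ β_k(G)` and `b_k(G) < ∞`. For the former, `f` outside the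
`k`-th power of the Hilbert ideal yields the invariant `∑ (g f) e_g` of `W ⊕ F[G]`, of degree one
more; taking the coefficient of `ε` in dual numbers shows that it avoids the `(k+1)`-st power
(`orbitSum_notMem`). Finiteness is Benson's argument, giving `b_k ≤ |G| k`. -/

namespace NoetherNumber

/-! ### Functoriality and grading of symmetric algebras. -/

section Symmetric

variable {F : Type*} [Field F] {W W' W'' : Type*} [AddCommGroup W] [Module F W]
  [AddCommGroup W'] [Module F W'] [AddCommGroup W''] [Module F W'']

/-- The algebra homomorphism of symmetric algebras induced by a linear map. -/
def symMap (f : W →ₗ[F] W') : SymmetricAlgebra F W →ₐ[F] SymmetricAlgebra F W' :=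
  SymmetricAlgebra.lift (SymmetricAlgebra.ι F W' ∘ₗ f)

@[simp]
lemma symMap_ι (f : W →ₗ[F] W') (w : W) :
    symMap f (SymmetricAlgebra.ι F W w) = SymmetricAlgebra.ι F W' (f w) := by
  simp [symMap]

lemma symMap_symMap (g : W' →ₗ[F] W'') (f : W →ₗ[F] W') (x : SymmetricAlgebra F W) :
    symMap g (symMap f x) = symMap (g ∘ₗ f) x := by
  have : (symMap g).comp (symMap f) = symMap (g ∘ₗ f) := by
    apply SymmetricAlgebra.algHom_ext
    ext x
    simp
  exact congr($this x)

lemma symMap_id (x : SymmetricAlgebra F W) : symMap LinearMap.id x = x := by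
  have : symMap (LinearMap.id : W →ₗ[F] W) = AlgHom.id F _ := by
    apply SymmetricAlgebra.algHom_ext
    ext x
    simp
  exact congr($this x)

lemma ι_mem_symComponent (w : W) : SymmetricAlgebra.ι F W w ∈ symComponent F W 1 := by
  simp [symComponent]

lemma symMap_mem_symComponent (f : W →ₗ[F] W') {d : ℕ} {x : SymmetricAlgebra F W}
    (hx : x ∈ symComponent F W d) : symMap f x ∈ symComponent F W' d := by
  have h : (symComponent F W d).map (symMap f).toLinearMap ≤ symComponent F W' d := by
    rw [symComponent, Submodule.map_pow]
    refine pow_le_pow_left' ?_ d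
    rintro _ ⟨_, ⟨w, rfl⟩, rfl⟩
    exact ⟨f w, by simp⟩
  exact h ⟨x, hx, rfl⟩

lemma mul_mem_symComponent {d e : ℕ} {x y : SymmetricAlgebra F W}
    (hx : x ∈ symComponent F W d) (hy : y ∈ symComponent F W e) :
    x * y ∈ symComponent F W (d + e) := by
  rw [symComponent, pow_add]
  exact Submodule.mul_mem_mul hx hy

lemma prod_ι_mem_symComponent {κ : Type*} (s : Finset κ) (w : κ → W) :
    ∏ i ∈ s, SymmetricAlgebra.ι F W (w i) ∈ symComponent F W s.card := by
  classical
  induction s using Finset.induction_on with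
  | empty => simp [symComponent]
  | insert a s ha ih =>
    rw [Finset.prod_insert ha, Finset.card_insert_of_notMem ha, add_comm]
    exact mul_mem_symComponent (ι_mem_symComponent _) ih

/-- The sum of the homogeneous components of positive degree. -/
def symPositive (F W : Type*) [Field F] [AddCommGroup W] [Module F W] :
    Submodule F (SymmetricAlgebra F W) :=
  ⨆ d : ℕ, symComponent F W (d + 1)

lemma symComponent_le_symPositive {d : ℕ} (hd : 0 < d) :
    symComponent F W d ≤ symPositive F W := by
  obtain ⟨e, rfl⟩ := Nat.exists_eq_succ_of_ne_zero hd.ne'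
  exact le_iSup (fun d : ℕ => symComponent F W (d + 1)) e

lemma mul_mem_symPositive {x y : SymmetricAlgebra F W} (hx : x ∈ symPositive F W)
    (hy : y ∈ symPositive F W) : x * y ∈ symPositive F W := by
  have h : symPositive F W * symPositive F W ≤ symPositive F W := by
    conv_lhs => rw [symPositive, Submodule.iSup_mul]
    refine iSup_le fun d => ?_
    rw [Submodule.mul_iSup]
    refine iSup_le fun e => ?_
    rw [symComponent, symComponent, ← pow_add]
    exact symComponent_le_symPositive (by omega)
  exact h (Submodule.mul_mem_mul hx hy)

lemma sub_algebraMap_mem_symPositive (x : SymmetricAlgebra F W) :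
    x - algebraMap F _ (SymmetricAlgebra.algebraMapInv x) ∈ symPositive F W := by
  induction x using SymmetricAlgebra.induction with
  | algebraMap r => simp
  | ι w =>
    simpa [SymmetricAlgebra.algebraMapInv_ι] using
      symComponent_le_symPositive one_pos (ι_mem_symComponent w)
  | mul a b ha hb =>
    -- With `a₀`, `b₀` the constant terms: `ab - a₀b₀ = (a - a₀)(b - b₀) + a₀(b - b₀) + b₀(a - a₀)`.
    have key := add_mem (add_mem (mul_mem_symPositive ha hb)
      (Submodule.smul_mem _ (SymmetricAlgebra.algebraMapInv a) hb))
      (Submodule.smul_mem _ (SymmetricAlgebra.algebraMapInv b) ha)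
    convert key using 1
    simp only [Algebra.smul_def, map_mul]
    ring
  | add a b ha hb =>
    convert add_mem ha hb using 1
    simp only [map_add]
    ring

lemma mem_symPositive_of_algebraMapInv {x : SymmetricAlgebra F W}
    (hx : SymmetricAlgebra.algebraMapInv x = 0) : x ∈ symPositive F W := by
  simpa [hx] using sub_algebraMap_mem_symPositive x

lemma algebraMapInv_symMap (f : W →ₗ[F] W') (x : SymmetricAlgebra F W) :
    SymmetricAlgebra.algebraMapInv (symMap f x) = SymmetricAlgebra.algebraMapInv x := by
  have : (SymmetricAlgebra.algebraMapInv).comp (symMap f) =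
      (SymmetricAlgebra.algebraMapInv : SymmetricAlgebra F W →ₐ[F] F) := by
    apply SymmetricAlgebra.algHom_ext
    ext x
    simp [SymmetricAlgebra.algebraMapInv_ι]
  exact congr($this x)

lemma algebraMapInv_of_mem_symComponent {d : ℕ} (hd : 0 < d) {x : SymmetricAlgebra F W}
    (hx : x ∈ symComponent F W d) : SymmetricAlgebra.algebraMapInv x = 0 := by
  have h : (symComponent F W d).map (SymmetricAlgebra.algebraMapInv (R := F)).toLinearMap ≤ ⊥ := by
    have h0 : (LinearMap.range (SymmetricAlgebra.ι F W)).map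
        (SymmetricAlgebra.algebraMapInv (R := F)).toLinearMap = ⊥ := by
      rw [eq_bot_iff]
      rintro _ ⟨_, ⟨w, rfl⟩, rfl⟩
      simp [SymmetricAlgebra.algebraMapInv_ι]
    rw [symComponent, Submodule.map_pow, h0, Submodule.bot_pow hd.ne']
  simpa using h ⟨x, hx, rfl⟩

lemma symMap_zero_of_mem_symComponent {d : ℕ} (hd : 0 < d) {x : SymmetricAlgebra F W}
    (hx : x ∈ symComponent F W d) : symMap (0 : W →ₗ[F] W') x = 0 := by
  have : symMap (0 : W →ₗ[F] W') =
      (Algebra.ofId F _).comp (SymmetricAlgebra.algebraMapInv (M := W)) := by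
    apply SymmetricAlgebra.algHom_ext
    ext x
    simp [SymmetricAlgebra.algebraMapInv_ι]
  rw [this, AlgHom.comp_apply, algebraMapInv_of_mem_symComponent hd hx, map_zero]

end Symmetric

/-! ### Top degrees of quotients. -/

section TopDegree

variable {F : Type*} [Field F] {M N : Type*} [AddCommGroup M] [Module F M]
  [AddCommGroup N] [Module F N]

lemma topDeg_le {X : ℕ → Submodule F M} {n : ℕ∞} (h : ∀ d : ℕ, X d ≠ ⊥ → (d : ℕ∞) ≤ n) :
    topDeg X ≤ n := by
  refine sSup_le ?_
  rintro _ ⟨d, hd, rfl⟩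
  exact h d hd

lemma le_topDeg {X : ℕ → Submodule F M} {d : ℕ} (h : X d ≠ ⊥) : (d : ℕ∞) ≤ topDeg X :=
  le_sSup ⟨d, h, rfl⟩

lemma map_mkₐ_ne_bot {A : Type*} [CommRing A] [Algebra F A] {I : Ideal A}
    {X : Submodule F A} :
    X.map (Ideal.Quotient.mkₐ F I).toLinearMap ≠ ⊥ ↔ ∃ x ∈ X, x ∉ I := by
  rw [Submodule.ne_bot_iff]
  constructor
  · rintro ⟨_, ⟨x, hx, rfl⟩, h⟩
    exact ⟨x, hx, fun h' => h (Ideal.Quotient.eq_zero_iff_mem.2 h')⟩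
  · rintro ⟨x, hx, h⟩
    exact ⟨_, ⟨x, hx, rfl⟩, fun h' => h (Ideal.Quotient.eq_zero_iff_mem.1 h')⟩

end TopDegree

/-! ### Invariants, their positive ideal and equivariant maps. -/

section Invariants

variable {F : Type*} [Field F] {G : Type*} [Group G] {H : Type*} [Group H]
  {W : Type*} [AddCommGroup W] [Module F W] {V : Type*} [AddCommGroup V] [Module F V]

lemma symAction_apply (ρ : Representation F G W) (g : G) (x : SymmetricAlgebra F W) :
    symAction ρ g x = symMap (ρ g) x := rfl

lemma symAction_mul_apply (ρ : Representation F G W) (g h : G) (x : SymmetricAlgebra F W) :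
    symAction ρ (g * h) x = symAction ρ g (symAction ρ h x) := by
  rw [map_mul]; rfl

lemma symAction_coe (ρ : Representation F G W) (a : invariants ρ) (g : G) :
    symAction ρ g (a : SymmetricAlgebra F W) = a := a.2 g

lemma mem_invPlus {ρ : Representation F G W} {d : ℕ} (hd : 0 < d) {a : invariants ρ}
    (ha : (a : SymmetricAlgebra F W) ∈ symComponent F W d) : a ∈ invPlus ρ :=
  Ideal.subset_span (Set.mem_iUnion.2 ⟨⟨d, hd⟩, ha⟩)

lemma invPlus_le {ρ : Representation F G W} {J : Ideal (invariants ρ)}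
    (h : ∀ d : ℕ, 0 < d → ∀ a : invariants ρ,
      (a : SymmetricAlgebra F W) ∈ symComponent F W d → a ∈ J) : invPlus ρ ≤ J := by
  refine Ideal.span_le.2 (Set.iUnion_subset ?_)
  rintro ⟨d, hd⟩ a ha
  exact h d hd a ha

lemma hilbertIdeal_eq_pow (k : ℕ) (ρ : Representation F G W) :
    hilbertIdeal k ρ = hilbertIdeal 1 ρ ^ k := by
  rw [hilbertIdeal, hilbertIdeal, Ideal.map_pow, pow_one]

lemma coe_mem_hilbertIdeal_one {ρ : Representation F G W} {a : invariants ρ}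
    (ha : a ∈ invPlus ρ) : (a : SymmetricAlgebra F W) ∈ hilbertIdeal 1 ρ := by
  rw [hilbertIdeal, pow_one]
  exact Ideal.mem_map_of_mem _ ha

lemma betaRep_le {k : ℕ} {ρ : Representation F G W} {n : ℕ∞}
    (h : ∀ (d : ℕ) (a : invariants ρ), (a : SymmetricAlgebra F W) ∈ symComponent F W d →
      a ∉ invPlus ρ ^ (k + 1) → (d : ℕ∞) ≤ n) : betaRep k ρ ≤ n := by
  refine topDeg_le fun d hd => ?_
  obtain ⟨a, ha, ha'⟩ := map_mkₐ_ne_bot.1 hd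
  exact h d a ha ha'

lemma le_betaRep {k : ℕ} {ρ : Representation F G W} {d : ℕ} {a : invariants ρ}
    (ha : (a : SymmetricAlgebra F W) ∈ symComponent F W d) (ha' : a ∉ invPlus ρ ^ (k + 1)) :
    (d : ℕ∞) ≤ betaRep k ρ :=
  le_topDeg (X := fun d : ℕ =>
    (invComponent ρ d).map (Ideal.Quotient.mkₐ F (invPlus ρ ^ (k + 1))).toLinearMap)
    (map_mkₐ_ne_bot.2 ⟨a, ha, ha'⟩)

lemma bRep_le {k : ℕ} {ρ : Representation F G W} {n : ℕ∞}
    (h : ∀ (d : ℕ), ∀ x ∈ symComponent F W d, x ∉ hilbertIdeal k ρ → (d : ℕ∞) ≤ n) :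
    bRep k ρ ≤ n := by
  refine topDeg_le fun d hd => ?_
  obtain ⟨a, ha, ha'⟩ := map_mkₐ_ne_bot.1 hd
  exact h d a ha ha'

lemma le_bRep {k : ℕ} {ρ : Representation F G W} {d : ℕ} {x : SymmetricAlgebra F W}
    (hx : x ∈ symComponent F W d) (hx' : x ∉ hilbertIdeal k ρ) : (d : ℕ∞) ≤ bRep k ρ :=
  le_topDeg (X := fun d : ℕ =>
    (symComponent F W d).map (Ideal.Quotient.mkₐ F (hilbertIdeal k ρ)).toLinearMap)
    (map_mkₐ_ne_bot.2 ⟨x, hx, hx'⟩)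

lemma symMap_symAction {τ : Representation F G W} {ρ : Representation F H V} {σ : H →* G}
    {p : W →ₗ[F] V} (hp : ∀ h, p ∘ₗ τ (σ h) = ρ h ∘ₗ p) (h : H) (x : SymmetricAlgebra F W) :
    symMap p (symAction τ (σ h) x) = symAction ρ h (symMap p x) := by
  rw [symAction_apply, symAction_apply, symMap_symMap, symMap_symMap, hp]

/-- The homomorphism of algebras of invariants induced by an equivariant linear map. -/
def invMap {τ : Representation F G W} {ρ : Representation F H V} (σ : H →* G)
    (p : W →ₗ[F] V) (hp : ∀ h, p ∘ₗ τ (σ h) = ρ h ∘ₗ p) : invariants τ →ₐ[F] invariants ρ :=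
  ((symMap p).comp (invariants τ).val).codRestrict (invariants ρ) fun a h => by
    rw [AlgHom.comp_apply, ← symMap_symAction hp]
    exact congrArg _ (a.2 (σ h))

lemma coe_invMap {τ : Representation F G W} {ρ : Representation F H V} (σ : H →* G)
    (p : W →ₗ[F] V) (hp : ∀ h, p ∘ₗ τ (σ h) = ρ h ∘ₗ p) (a : invariants τ) :
    (invMap σ p hp a : SymmetricAlgebra F V) = symMap p a := rfl

lemma map_invMap_invPlus_le {τ : Representation F G W} {ρ : Representation F H V} (σ : H →* G)
    (p : W →ₗ[F] V) (hp : ∀ h, p ∘ₗ τ (σ h) = ρ h ∘ₗ p) :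
    (invPlus τ).map (invMap σ p hp) ≤ invPlus ρ := by
  rw [Ideal.map_le_iff_le_comap]
  refine invPlus_le fun d hd a ha => ?_
  exact mem_invPlus hd (symMap_mem_symComponent p ha)

lemma invMap_mem_invPlus_pow {τ : Representation F G W} {ρ : Representation F H V} (σ : H →* G)
    (p : W →ₗ[F] V) (hp : ∀ h, p ∘ₗ τ (σ h) = ρ h ∘ₗ p) {k : ℕ} {a : invariants τ}
    (ha : a ∈ invPlus τ ^ k) : invMap σ p hp a ∈ invPlus ρ ^ k := by
  have h := Ideal.mem_map_of_mem (invMap σ p hp) ha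
  rw [Ideal.map_pow] at h
  exact Ideal.pow_right_mono (map_invMap_invPlus_le σ p hp) k h

end Invariants

/-! ### The transfer map. -/

section Transfer

variable {F : Type*} [Field F] {G : Type*} [Group G] [Fintype G]
  {W : Type*} [AddCommGroup W] [Module F W]

/-- The transfer `x ↦ ∑ g, g x` from the symmetric algebra to the invariants. -/
def transfer (ρ : Representation F G W) : SymmetricAlgebra F W →ₗ[F] invariants ρ where
  toFun x := ⟨∑ g, symAction ρ g x, fun h => by
    rw [map_sum]
    simp_rw [← symAction_mul_apply]
    exact Fintype.sum_equiv (Equiv.mulLeft h) _ _ fun _ => rfl⟩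
  map_add' x y := by
    ext
    simp [Finset.sum_add_distrib]
  map_smul' c x := by
    ext
    simp [Finset.smul_sum]

lemma coe_transfer (ρ : Representation F G W) (x : SymmetricAlgebra F W) :
    (transfer ρ x : SymmetricAlgebra F W) = ∑ g, symAction ρ g x := rfl

lemma transfer_mul (ρ : Representation F G W) (a : invariants ρ) (x : SymmetricAlgebra F W) :
    transfer ρ (a * x) = a * transfer ρ x := by
  ext
  simp [coe_transfer, Finset.mul_sum, symAction_coe]

lemma transfer_coe (ρ : Representation F G W) (a : invariants ρ) :
    transfer ρ a = (Fintype.card G : F) • a := by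
  ext
  simp [coe_transfer, symAction_coe, Algebra.smul_def]

lemma transfer_mem_invPlus (ρ : Representation F G W) {x : SymmetricAlgebra F W}
    (hx : x ∈ symPositive F W) : transfer ρ x ∈ invPlus ρ := by
  have h : symPositive F W ≤ ((invPlus ρ).restrictScalars F).comap (transfer ρ) := by
    refine iSup_le fun d x hx => ?_
    exact mem_invPlus d.succ_pos (sum_mem fun g _ => symMap_mem_symComponent _ hx)
  exact h hx

end Transfer

/-! ### Comparison along an equivariant retraction. -/

section Retract

variable {F : Type*} [Field F] {G : Type*} [Group G] {H : Type*} [Group H] [Fintype H]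
  {W : Type*} [AddCommGroup W] [Module F W] {V : Type*} [AddCommGroup V] [Module F V]
  {τ : Representation F G W} {ρ : Representation F H V}

lemma transfer_symMap_sub_mem {σ : H →* G} {p : W →ₗ[F] V}
    (hp : ∀ h, p ∘ₗ τ (σ h) = ρ h ∘ₗ p) (g : G) {k : ℕ} {x : SymmetricAlgebra F W}
    (hx : x ∈ hilbertIdeal k τ) :
    transfer ρ (symMap p x - symMap p (symAction τ g x)) ∈ invPlus ρ ^ (k + 1) := by
  -- The condition on `x` is not visibly closed under multiplication by `S(W)`; quantifying over a
  -- multiplier `s` makes it so.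
  suffices h : ∀ s, transfer ρ (symMap p (s * x) - symMap p (symAction τ g (s * x))) ∈
      invPlus ρ ^ (k + 1) by simpa using h 1
  induction hx using Submodule.span_induction with
  | mem x hx =>
    obtain ⟨a, ha, rfl⟩ := hx
    intro s
    have h0 : algebraMap (invariants τ) (SymmetricAlgebra F W) a = a := rfl
    have h1 : symMap p (s * a) - symMap p (symAction τ g (s * a)) =
        (invMap σ p hp a : SymmetricAlgebra F V) *
          (symMap p s - symMap p (symAction τ g s)) := by
      rw [map_mul, map_mul, map_mul, symAction_coe, coe_invMap]
      ring
    rw [h0, h1, transfer_mul, pow_succ]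
    refine Ideal.mul_mem_mul (invMap_mem_invPlus_pow σ p hp ha)
      (transfer_mem_invPlus ρ (mem_symPositive_of_algebraMapInv ?_))
    rw [map_sub, algebraMapInv_symMap, algebraMapInv_symMap, symAction_apply,
      algebraMapInv_symMap, sub_self]
  | zero => simp
  | add x y _ _ ihx ihy =>
    intro s
    convert add_mem (ihx s) (ihy s) using 1
    rw [← map_add]
    congr 1
    simp only [mul_add, map_add]
    ring
  | smul c x _ ih =>
    intro s
    simpa [mul_assoc] using ih (s * c)

/-- The element `i(a)` is the witness: `p` recovers `a` from it, whereas `p g` kills it, so the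
transferred difference is `|H| a`. -/
lemma betaRep_le_bRep_of_retract (hcard : (Fintype.card H : F) ≠ 0) (σ : H →* G)
    (i : V →ₗ[F] W) (p : W →ₗ[F] V) (hp : ∀ h, p ∘ₗ τ (σ h) = ρ h ∘ₗ p)
    (hpi : p ∘ₗ i = LinearMap.id) (g : G) (hg : p ∘ₗ τ g ∘ₗ i = 0) (k : ℕ) :
    betaRep k ρ ≤ bRep k τ := by
  refine betaRep_le fun d a ha ha' => ?_
  -- Constants are not killed by `p g i = 0`, but the bound is trivial in degree 0.
  rcases d.eq_zero_or_pos with rfl | hd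
  · simp
  refine le_bRep (symMap_mem_symComponent i ha) fun hmem => ha' ?_
  have h := transfer_symMap_sub_mem hp g hmem
  rw [symAction_apply, symMap_symMap, symMap_symMap, symMap_symMap, hpi, symMap_id,
    LinearMap.comp_assoc, hg, symMap_zero_of_mem_symComponent hd ha, sub_zero, transfer_coe] at h
  have h' := Submodule.smul_of_tower_mem (invPlus ρ ^ (k + 1)) ((Fintype.card H : F)⁻¹) h
  rwa [smul_smul, inv_mul_cancel₀ hcard, one_smul] at h'

end Retract


/-! ### The induced module retracts onto `V`. -/

section Induced

variable {F : Type*} [Field F] {G : Type*} [Group G] {H : Subgroup G}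
  {V : Type*} [AddCommGroup V] [Module F V] (ρ : Representation F H V)

open scoped Classical in
/-- The `H`-equivariant projection of `Ind_H^G V` onto `V`. -/
noncomputable def indProj : Representation.IndV H.subtype ρ →ₗ[F] V :=
  Representation.Coinvariants.lift _
    -- In the coinvariants `(h g, h v)` is identified with `(g, v)`, so for `g ∈ H` the class of
    -- `(g, v)` is that of `(1, g⁻¹ v)`; hence the inverse.
    (TensorProduct.lift <| (Finsupp.lift _ _ _ fun g : G =>
        if hg : g ∈ H then ρ ⟨g, hg⟩⁻¹ else 0) ∘ₗ
      (MonoidAlgebra.coeffLinearEquiv F).toLinearMap)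
    fun h => by
      ext g v
      by_cases hg : g ∈ H
      · have : ρ (⟨(h : G) * g, mul_mem h.2 hg⟩ : H)⁻¹ (ρ h v) = ρ (⟨g, hg⟩ : H)⁻¹ v := by
          have : (⟨(h : G) * g, mul_mem h.2 hg⟩ : H) = h * ⟨g, hg⟩ := rfl
          rw [this, mul_inv_rev, ← Module.End.mul_apply, ← map_mul, inv_mul_cancel_right]
        simpa [hg, Subgroup.mul_mem_cancel_left H h.2] using this
      · simp [hg, Subgroup.mul_mem_cancel_left H h.2]

open scoped Classical in
lemma indProj_mk (g : G) (v : V) :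
    indProj ρ (Representation.IndV.mk H.subtype ρ g v) =
      if hg : g ∈ H then ρ (⟨g, hg⟩ : H)⁻¹ v else 0 := by
  simp only [indProj, LinearMap.comp_apply, Representation.Coinvariants.lift_mk]
  by_cases hg : g ∈ H <;> simp [hg]

lemma indProj_comp_ind (h : H) :
    indProj ρ ∘ₗ Representation.ind H.subtype ρ (H.subtype h) = ρ h ∘ₗ indProj ρ := by
  refine Representation.IndV.hom_ext _ _ fun g => LinearMap.ext fun v => ?_
  simp only [LinearMap.comp_apply]
  have key := Representation.ind_mk H.subtype ρ (h : G) g v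
  simp only [LinearMap.comp_apply] at key
  have h1 := indProj_mk ρ (g * (h : G)⁻¹) v
  have h2 := indProj_mk ρ g v
  simp only [LinearMap.comp_apply] at h1 h2
  rw [Subgroup.subtype_apply, key, h1, h2]
  by_cases hg : g ∈ H
  · have hgh : g * (h : G)⁻¹ ∈ H := mul_mem hg (inv_mem h.2)
    rw [dif_pos hgh, dif_pos hg, ← Module.End.mul_apply, ← map_mul]
    congr 2
    ext
    simp
  · have hgh : g * (h : G)⁻¹ ∉ H := by
      rwa [Subgroup.mul_mem_cancel_right H (inv_mem h.2)]
    rw [dif_neg hgh, dif_neg hg, map_zero]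

lemma indProj_comp_mk_one :
    indProj ρ ∘ₗ Representation.IndV.mk H.subtype ρ 1 = LinearMap.id := by
  ext v
  rw [LinearMap.comp_apply, indProj_mk, dif_pos (one_mem H)]
  have : (⟨1, one_mem H⟩ : H)⁻¹ = 1 := by ext; simp
  rw [this, map_one]
  rfl

lemma indProj_comp_ind_comp_mk_one {g : G} (hg : g ∉ H) :
    indProj ρ ∘ₗ Representation.ind H.subtype ρ g ∘ₗ Representation.IndV.mk H.subtype ρ 1 = 0 := by
  ext v
  rw [LinearMap.comp_apply, LinearMap.comp_apply, Representation.ind_mk, indProj_mk, dif_neg]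
  · rfl
  · simpa using hg

/-- If `H` is a proper subgroup, then `β_k(H, V) ≤ b_k(G, Ind_H^G V)`. -/
theorem betaRep_le_bRep_ind [Fintype H] (hcard : (Fintype.card H : F) ≠ 0) (hH : H ≠ ⊤) (k : ℕ) :
    betaRep k ρ ≤ bRep k (Representation.ind H.subtype ρ) := by
  obtain ⟨g, hg⟩ : ∃ g, g ∉ H := by
    by_contra! h
    exact hH ((Subgroup.eq_top_iff' H).2 h)
  exact betaRep_le_bRep_of_retract hcard H.subtype _ _ (indProj_comp_ind ρ)
    (indProj_comp_mk_one ρ) g (indProj_comp_ind_comp_mk_one ρ hg) k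

end Induced

/-! ### Finiteness of `b_k`. -/

section Bound

variable {F : Type*} [Field F] {G : Type*} [Group G] [Fintype G]
  {W : Type*} [AddCommGroup W] [Module F W]

/-- Benson's argument: a product of `|G|` linear forms lies in the Hilbert ideal. -/
lemma prod_ι_mem_hilbertIdeal (hcard : (Fintype.card G : F) ≠ 0) (ρ : Representation F G W)
    (w : G → W) : ∏ g, SymmetricAlgebra.ι F W (w g) ∈ hilbertIdeal 1 ρ := by
  classical
  let ι := SymmetricAlgebra.ι F W
  have hzero : ∑ t : Finset G,
      (transfer ρ (∏ g ∈ t, ι (ρ g (-w g))) : SymmetricAlgebra F W) * ∏ g ∈ tᶜ, ι (w g) = 0 := by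
    -- The factor at `g = h⁻¹` is `-w g + w g`. Summing the expanded products over `h` turns the
    -- coefficients into transfers.
    have h1 : ∀ h : G, ∏ g, (ι (ρ (h * g) (-w g)) + ι (w g)) = 0 := fun h =>
      Finset.prod_eq_zero (Finset.mem_univ h⁻¹) (by simp)
    have h2 : ∑ h : G, ∏ g, (ι (ρ (h * g) (-w g)) + ι (w g)) = 0 :=
      Finset.sum_eq_zero fun h _ => h1 h
    simp_rw [Fintype.prod_add] at h2
    rw [Finset.sum_comm] at h2
    rw [← h2]
    refine Finset.sum_congr rfl fun t _ => ?_
    rw [coe_transfer, Finset.sum_mul]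
    refine Finset.sum_congr rfl fun h _ => ?_
    simp [symAction_apply, map_prod, ι, map_mul]
  -- The term `t = ∅` is `|G| ∏ w g`; every other term contains a transfer of positive degree.
  rw [← Finset.add_sum_erase _ _ (Finset.mem_univ ∅)] at hzero
  have hmem : (transfer ρ (∏ g ∈ (∅ : Finset G), ι (ρ g (-w g))) : SymmetricAlgebra F W) *
      ∏ g ∈ (∅ : Finset G)ᶜ, ι (w g) ∈ hilbertIdeal 1 ρ := by
    rw [eq_neg_of_add_eq_zero_left hzero]
    refine neg_mem (sum_mem fun t ht => Ideal.mul_mem_right _ _ (coe_mem_hilbertIdeal_one ?_))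
    refine transfer_mem_invPlus ρ (symComponent_le_symPositive ?_ (prod_ι_mem_symComponent t _))
    exact Finset.card_pos.2 (Finset.nonempty_iff_ne_empty.2 (Finset.ne_of_mem_erase ht))
  have h1 : transfer ρ 1 = (Fintype.card G : F) • (1 : invariants ρ) := transfer_coe ρ 1
  rw [Finset.prod_empty, h1, Finset.compl_empty] at hmem
  have h' := Submodule.smul_of_tower_mem (hilbertIdeal 1 ρ) ((Fintype.card G : F)⁻¹) hmem
  simpa [smul_smul, hcard] using h'

lemma symComponent_card_le_hilbertIdeal (hcard : (Fintype.card G : F) ≠ 0)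
    (ρ : Representation F G W) :
    symComponent F W (Fintype.card G) ≤ (hilbertIdeal 1 ρ).restrictScalars F := by
  rw [symComponent, Submodule.pow_eq_span_pow_set, Submodule.span_le]
  intro x hx
  obtain ⟨f, rfl⟩ := Set.mem_pow.1 hx
  choose w hw using fun i => (f i).2
  rw [List.prod_ofFn]
  have h := prod_ι_mem_hilbertIdeal hcard ρ (w ∘ Fintype.equivFin G)
  have h' : ∏ g, SymmetricAlgebra.ι F W ((w ∘ Fintype.equivFin G) g) =
      ∏ i, (f i : SymmetricAlgebra F W) :=
    Fintype.prod_equiv (Fintype.equivFin G) _ _ fun g => hw _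
  rwa [h'] at h

lemma symComponent_le_hilbertIdeal (hcard : (Fintype.card G : F) ≠ 0)
    (ρ : Representation F G W) {k d : ℕ} (hd : Fintype.card G * k ≤ d) :
    symComponent F W d ≤ (hilbertIdeal k ρ).restrictScalars F := by
  have h (k : ℕ) : symComponent F W (Fintype.card G * k) ≤
      (hilbertIdeal k ρ).restrictScalars F := by
    induction k with
    | zero =>
      rw [hilbertIdeal_eq_pow, pow_zero, Ideal.one_eq_top]
      exact le_top
    | succ k ih =>
      rw [symComponent, mul_add_one, pow_add, Submodule.mul_le]
      intro x hx y hy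
      change x * y ∈ hilbertIdeal (k + 1) ρ
      rw [hilbertIdeal_eq_pow, pow_succ, ← hilbertIdeal_eq_pow]
      exact Ideal.mul_mem_mul (ih hx) (symComponent_card_le_hilbertIdeal hcard ρ hy)
  obtain ⟨e, rfl⟩ := Nat.exists_eq_add_of_le hd
  rw [symComponent, pow_add, Submodule.mul_le]
  exact fun x hx y _ => Ideal.mul_mem_right _ _ (h k hx)

lemma bRep_le_card_mul (hcard : (Fintype.card G : F) ≠ 0) (ρ : Representation F G W) (k : ℕ) :
    bRep k ρ ≤ (Fintype.card G * k : ℕ) := by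
  refine bRep_le fun d x hx hx' => ?_
  by_contra! h
  exact hx' (symComponent_le_hilbertIdeal hcard ρ (Nat.cast_lt.1 h).le hx)

end Bound

/-! ### Raising the degree by adding the regular module. -/

section Regular

open TrivSqZeroExt

lemma fst_mem_pow_of_mem_pow {A T : Type*} [CommRing A] [CommRing T] (Ψ : A →+* DualNumber T)
    {I : Ideal A} {J : Ideal T} (h : ∀ a ∈ I, (Ψ a).fst ∈ J) (k : ℕ) :
    ∀ a ∈ I ^ k, (Ψ a).fst ∈ J ^ k := by
  have hle : I ≤ J.comap ((fstHom T T T : DualNumber T →+* T).comp Ψ) := h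
  have hle' := (Ideal.pow_right_mono hle k).trans (Ideal.le_comap_pow _ k)
  exact fun a ha => hle' ha

/-- The coefficient of `ε` obeys the Leibniz rule, so differentiating a product of `k + 1` elements
costs just one factor. -/
lemma snd_mem_pow_of_mem_pow_succ {A T : Type*} [CommRing A] [CommRing T]
    (Ψ : A →+* DualNumber T) {I : Ideal A} {J : Ideal T} (h : ∀ a ∈ I, (Ψ a).fst ∈ J) (k : ℕ) :
    ∀ a ∈ I ^ (k + 1), (Ψ a).snd ∈ J ^ k := by
  induction k with
  | zero => simp
  | succ k ih =>
    intro a ha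
    rw [pow_succ] at ha
    induction ha using Submodule.mul_induction_on' with
    | mem_mul_mem x hx y hy =>
      rw [map_mul, DualNumber.snd_mul]
      refine add_mem (Ideal.mul_mem_right _ _ (fst_mem_pow_of_mem_pow Ψ h _ x hx)) ?_
      rw [pow_succ]
      exact Ideal.mul_mem_mul (ih x hx) (h y hy)
    | add x _ y _ hx hy =>
      rw [map_add, snd_add]
      exact add_mem hx hy

variable {F : Type*} [Field F] {G : Type*} [Group G]
  {W : Type*} [AddCommGroup W] [Module F W]

/-- The homomorphism from `S(W ⊕ F[G])` to the dual numbers over `S(W)` that sends the basis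
element `1` of `F[G]` to `ε` and the other group elements to `0`. -/
noncomputable def dualHom (F G W : Type*) [Field F] [Group G] [AddCommGroup W] [Module F W] :
    SymmetricAlgebra F (W × MonoidAlgebra F G) →ₐ[F] DualNumber (SymmetricAlgebra F W) :=
  SymmetricAlgebra.lift <|
    (inlAlgHom F (SymmetricAlgebra F W) (SymmetricAlgebra F W)).toLinearMap ∘ₗ
        SymmetricAlgebra.ι F W ∘ₗ LinearMap.fst F W _ +
      (inrHom (SymmetricAlgebra F W) (SymmetricAlgebra F W)).restrictScalars F ∘ₗ
        Algebra.linearMap F _ ∘ₗ Finsupp.lapply 1 ∘ₗ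
          (MonoidAlgebra.coeffLinearEquiv F).toLinearMap ∘ₗ LinearMap.snd F W _

lemma dualHom_ι (w : W) (x : MonoidAlgebra F G) :
    dualHom F G W (SymmetricAlgebra.ι F _ (w, x)) =
      inl (SymmetricAlgebra.ι F W w) + inr (algebraMap F _ (x.coeff 1)) := by
  simp [dualHom]

lemma fst_dualHom (x : SymmetricAlgebra F (W × MonoidAlgebra F G)) :
    (dualHom F G W x).fst = symMap (LinearMap.fst F W _) x := by
  have : (fstHom F (SymmetricAlgebra F W) (SymmetricAlgebra F W)).comp (dualHom F G W) =
      symMap (LinearMap.fst F W _) := by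
    apply SymmetricAlgebra.algHom_ext
    refine LinearMap.ext fun ⟨w, x⟩ => ?_
    simp [dualHom_ι]
  exact congr($this x)

lemma dualHom_symMap_inl (x : SymmetricAlgebra F W) :
    dualHom F G W (symMap (LinearMap.inl F W _) x) = inl x := by
  have : (dualHom F G W).comp (symMap (LinearMap.inl F W _)) =
      inlAlgHom F (SymmetricAlgebra F W) (SymmetricAlgebra F W) := by
    apply SymmetricAlgebra.algHom_ext
    ext w : 1
    simp [dualHom_ι]
  exact congr($this x)

/-- The invariant `∑ g, (g f) e_g` of `S(W ⊕ F[G])` attached to `f ∈ S(W)`. -/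
noncomputable def orbitSum [Fintype G] (ρ : Representation F G W) (f : SymmetricAlgebra F W) :
    invariants (ρ.prod (Representation.leftRegular F G)) :=
  ⟨∑ g, symMap (LinearMap.inl F W _) (symAction ρ g f) *
      SymmetricAlgebra.ι F _ (0, MonoidAlgebra.single g 1), fun h => by
    rw [map_sum]
    refine Fintype.sum_equiv (Equiv.mulLeft h) _ _ fun g => ?_
    rw [map_mul, Equiv.coe_mulLeft, symAction_mul_apply,
      ← symMap_symAction (τ := ρ) (ρ := ρ.prod (Representation.leftRegular F G))
        (σ := MonoidHom.id G) (fun h => by ext <;> simp), MonoidHom.id_apply]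
    congr 1
    rw [symAction_apply, symMap_ι]
    simp⟩

lemma coe_orbitSum_mem [Fintype G] (ρ : Representation F G W) {d : ℕ}
    {f : SymmetricAlgebra F W} (hf : f ∈ symComponent F W d) :
    (orbitSum ρ f : SymmetricAlgebra F (W × MonoidAlgebra F G)) ∈ symComponent F _ (d + 1) :=
  sum_mem fun _ _ => mul_mem_symComponent
    (symMap_mem_symComponent _ (symMap_mem_symComponent _ hf)) (ι_mem_symComponent _)

lemma snd_dualHom_orbitSum [Fintype G] (ρ : Representation F G W) (f : SymmetricAlgebra F W) :
    (dualHom F G W (orbitSum ρ f)).snd = f := by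
  classical
  have h : dualHom F G W (orbitSum ρ f) = inr f := by
    simp only [orbitSum, map_sum, map_mul, dualHom_symMap_inl, dualHom_ι, map_zero, inl_zero,
      zero_add]
    rw [Finset.sum_eq_single 1]
    · ext <;> simp
    · intro g _ hg
      simp [hg]
    · simp
  rw [h, snd_inr]

/-- Positive invariants of `W ⊕ F[G]` project to positive invariants of `W`, so the `ε`-coefficient
of anything in the `(k+1)`-st power lies in `hilbertIdeal k ρ`; for the orbit sum this coefficient
is `f`. -/
lemma orbitSum_notMem [Fintype G] (ρ : Representation F G W) {k : ℕ}
    {f : SymmetricAlgebra F W} (hf : f ∉ hilbertIdeal k ρ) :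
    orbitSum ρ f ∉ invPlus (ρ.prod (Representation.leftRegular F G)) ^ (k + 1) := by
  intro hmem
  have h := snd_mem_pow_of_mem_pow_succ (((dualHom F G W).comp (invariants
    (ρ.prod (Representation.leftRegular F G))).val : _ →ₐ[F] _) : _ →+* _)
    (J := hilbertIdeal 1 ρ) (fun a ha => ?_) k _ hmem
  · rw [← hilbertIdeal_eq_pow] at h
    refine hf ?_
    have h' : (dualHom F G W (orbitSum ρ f)).snd ∈ hilbertIdeal k ρ := h
    rwa [snd_dualHom_orbitSum] at h'
  · change (dualHom F G W (a : SymmetricAlgebra F (W × MonoidAlgebra F G))).fst ∈ _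
    rw [fst_dualHom]
    have hp : ∀ h : G, LinearMap.fst F W (MonoidAlgebra F G) ∘ₗ
        (ρ.prod (Representation.leftRegular F G)) (MonoidHom.id G h) =
        ρ h ∘ₗ LinearMap.fst F W (MonoidAlgebra F G) := fun h => rfl
    have ha' := invMap_mem_invPlus_pow (MonoidHom.id G) _ hp (k := 1) (by simpa using ha)
    rw [pow_one] at ha'
    exact coe_mem_hilbertIdeal_one ha'

lemma succ_le_betaRep_prod [Fintype G] (ρ : Representation F G W) {k d : ℕ}
    {f : SymmetricAlgebra F W} (hf : f ∈ symComponent F W d) (hf' : f ∉ hilbertIdeal k ρ) :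
    (d + 1 : ℕ∞) ≤ betaRep k (ρ.prod (Representation.leftRegular F G)) := by
  exact_mod_cast le_betaRep (coe_orbitSum_mem ρ hf) (orbitSum_notMem ρ hf')

lemma one_notMem_hilbertIdeal (ρ : Representation F G W) {k : ℕ} (hk : 1 ≤ k) :
    (1 : SymmetricAlgebra F W) ∉ hilbertIdeal k ρ := by
  have h1 : hilbertIdeal 1 ρ ≤ RingHom.ker (SymmetricAlgebra.algebraMapInv (R := F) (M := W)) := by
    rw [hilbertIdeal, pow_one, Ideal.map_le_iff_le_comap]
    exact invPlus_le fun d hd a ha => algebraMapInv_of_mem_symComponent hd ha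
  intro h
  rw [hilbertIdeal_eq_pow] at h
  simpa using h1 (Ideal.pow_le_self (by omega) h)

end Regular

/-! ### Passage to the suprema. -/

section Suprema

variable {F : Type u} [Field F] {G : Type v} [Group G]

lemma betaRep_le_beta {W : Type (max u v)} [hA : AddCommGroup W] [hM : Module F W]
    [hN : Module.Finite F W]
    (k : ℕ) (ρ : Representation F G W) : betaRep k ρ ≤ beta F G k := by
  refine le_iSup_of_le W ?_
  refine le_iSup_of_le hA ?_
  refine le_iSup_of_le hM ?_
  refine le_iSup_of_le hN ?_
  exact le_iSup (fun ρ : Representation F G W => betaRep k ρ) ρ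

lemma bRep_le_b {W : Type (max u v)} [hA : AddCommGroup W] [hM : Module F W]
    [hN : Module.Finite F W]
    (k : ℕ) (ρ : Representation F G W) : bRep k ρ ≤ b F G k := by
  refine le_iSup_of_le W ?_
  refine le_iSup_of_le hA ?_
  refine le_iSup_of_le hM ?_
  refine le_iSup_of_le hN ?_
  exact le_iSup (fun ρ : Representation F G W => bRep k ρ) ρ

lemma b_lt_top [Fintype G] (hcard : (Fintype.card G : F) ≠ 0) (k : ℕ) : b F G k < ⊤ := by
  refine lt_of_le_of_lt ?_ (ENat.natCast_lt_top (Fintype.card G * k))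
  exact iSup_le fun W => iSup_le fun _ => iSup_le fun _ => iSup_le fun _ => iSup_le fun ρ =>
    bRep_le_card_mul hcard ρ k

lemma b_add_one_le_beta [Fintype G] {k : ℕ} (hk : 1 ≤ k) : b F G k + 1 ≤ beta F G k := by
  have key {W : Type (max u v)} [AddCommGroup W] [Module F W] [Module.Finite F W]
      (ρ : Representation F G W) {d : ℕ} {f : SymmetricAlgebra F W}
      (hf : f ∈ symComponent F W d) (hf' : f ∉ hilbertIdeal k ρ) :
      (d + 1 : ℕ∞) ≤ beta F G k :=
    (succ_le_betaRep_prod ρ hf hf').trans (betaRep_le_beta k _)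
  -- Needed because subtraction in `ℕ∞` truncates; the constant 1 on the zero module is the witness.
  have hone : 1 ≤ beta F G k := by
    simpa using key (W := PUnit) (Representation.trivial F G PUnit.{max u v + 1}) (d := 0) (f := 1)
      (by simp [symComponent]) (one_notMem_hilbertIdeal _ hk)
  rw [← tsub_add_cancel_of_le hone]
  gcongr
  refine iSup_le fun W => iSup_le fun _ => iSup_le fun _ => iSup_le fun _ => iSup_le fun ρ =>
    bRep_le fun d f hf hf' => ?_
  exact ENat.le_sub_of_add_le_right (by simp) (key ρ hf hf')

end Suprema

end NoetherNumber

theorem theorem4p1 {F : Type u} [Field F] {G : Type v} [Group G] [Finite G]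
    (hF : ¬ ringChar F ∣ Nat.card G) (H : Subgroup G) (hH : H ≠ ⊤) (k : ℕ) (hk : 1 ≤ k) :
    (∀ (V : Type w) [AddCommGroup V] [Module F V] [Module.Finite F V]
      (ρ : Representation F H V),
      NoetherNumber.betaRep k ρ ≤ NoetherNumber.bRep k (Representation.ind H.subtype ρ)) ∧
    NoetherNumber.beta F H k ≤ NoetherNumber.b F G k ∧
    NoetherNumber.beta F H k < NoetherNumber.beta F G k := by
  classical
  have := Fintype.ofFinite G
  have hG : (Fintype.card G : F) ≠ 0 := by
    rwa [← Nat.card_eq_fintype_card, Ne, ringChar.spec]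
  have hcardH : (Fintype.card H : F) ≠ 0 := by
    rw [← Nat.card_eq_fintype_card, Ne, ringChar.spec]
    exact fun h => hF (h.trans H.card_subgroup_dvd_card)
  have hle : NoetherNumber.beta F H k ≤ NoetherNumber.b F G k :=
    iSup_le fun V => iSup_le fun _ => iSup_le fun _ => iSup_le fun _ => iSup_le fun ρ =>
      (NoetherNumber.betaRep_le_bRep_ind ρ hcardH hH k).trans (NoetherNumber.bRep_le_b k _)
  refine ⟨fun V _ _ _ ρ => NoetherNumber.betaRep_le_bRep_ind ρ hcardH hH k, hle, ?_⟩
  refine hle.trans_lt (lt_of_lt_of_le ?_ (NoetherNumber.b_add_one_le_beta hk))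
  exact (ENat.lt_add_one_iff (NoetherNumber.b_lt_top hG k).ne).2 le_rfl
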